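/- Let $X$ be a compact metric space with metric $d$ and let $T:X\to X$ be continuous. Let $\mathcal M_{\rm inv}$ be the set of $T$-invariant Borel probability measures on $X$, and for $\mu\in\mathcal M_{\rm inv}$ let $h_\mu\in[0,\infty]$ be its measure-theoretic (Kolmogorov–Sinai) entropy. For $Z\subset X$, let $h_{\rm top}(Z)\in[0,\infty]$ be Bowen's topological entropy of $Z$. It is defined as follows. Let $B_n(x,\epsilon)=\{y\in X: d(T^jx,T^jy)<\epsilon \text{ for } 0\le j<n\}$. For $s\ge 0$ and $\epsilon>0$, let $H^s_n(Z,\epsilon)=\inf\sum_i e^{-sn_i}$, the infimum being over all at most countable covers of $Z$ by balls $B_{n_i}(x_i,\epsilon)$ with all $n_i\ge n$, and let $H^s(Z,\epsilon)=\lim_{n\to\infty}H^s_n(Z,\epsilon)$. Let $h_{\rm top}(Z,\epsilon)=\inf\{s\ge0: H^s(Z,\epsilon)=0\}$ (with $\inf\emptyset=\infty$) and $h_{\rm top}(Z)=\lim_{\epsilon\to0}h_{\rm top}(Z,\epsilon)$. In particular $h_{\rm top}(\emptyset)=0$. Suppose that $(X,T)$ is saturated, that is, $h_{\rm top}(G_\mu)=h_\mu$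 for every $\mu\in\mathcal M_{\rm inv}$, where $G_\mu$ is the set of $x\in X$ for which $\frac1n\sum_{j=0}^{n-1}\delta_{T^jx}\to\mu$ in the weak star topology. Let $\mathbb B$ be a real Banach space and let its dual $\mathbb B^*$ carry the weak star topology $\sigma(\mathbb B^*,\mathbb B)$. Let $\Phi:X\to\mathbb B^*$ be continuous and put $A_n\Phi(x)=\frac1n\sum_{j=0}^{n-1}\Phi(T^jx)$ for $n\ge1$. For $\mu\in\mathcal M_{\rm inv}$ let $\int\Phi\,d\mu\in\mathbb B^*$ be the Pettis integral, $\langle\int\Phi\,d\mu,w\rangle=\int\langle\Phi,w\rangle\,d\mu$ for $w\in\mathbb B$. Let $Y$ be a topological space in which every sequence has at most one limit (for instance a Hausdorff space), let $\Psi$ be a continuous map into $Y$ from the closed convex hull of $\Phi(X)$ in $\mathbb B^*$, and let $\beta\in Y$. Set $$X_\Phi^\Psi(\beta)=\Bigl\{x\in X:\ \lim_{n\to\infty}\Psi(A_n\Phi(x))=\beta\Bigr\},$$ $$\widehat X_\Phi^\Psi(\beta)=\Bigl\{x\in X:\ \lim_{n\to\infty}A_n\Phi(x)\text{ exists and }\Psi\bigl(\lim_{n\to\infty}A_n\Phi(x)\bigr)=\beta\Bigr\},$$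 $$\mathcal M_\Phi^\Psi(\beta)=\Bigl\{\mu\in\mathcal M_{\rm inv}:\ \Psi\Bigl(\int\Phi\,d\mu\Bigr)=\beta\Bigr\}.$$ Then: 1. if $\mathcal M_\Phi^\Psi(\beta)=\emptyset$, then $X_\Phi^\Psi(\beta)=\emptyset$; 2. if $\mathcal M_\Phi^\Psi(\beta)\neq\emptyset$, then $$h_{\rm top}\bigl(X_\Phi^\Psi(\beta)\bigr)=h_{\rm top}\bigl(\widehat X_\Phi^\Psi(\beta)\bigr)=\sup_{\mu\in\mathcal M_\Phi^\Psi(\beta)}h_\mu .$$ -/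

import Mathlib

open MeasureTheory Filter Topology Set
open scoped ENNReal NNReal

noncomputable section

namespace SaturatedSystem

/-! ### Bowen's topological entropy of a subset -/

section TopologicalEntropy

variable {X : Type*} [MetricSpace X]

/-- The open ball `B_n(x, ε)` of the metric `d_n(x, y) = max_{0 ≤ j < n} d(T^j x, T^j y)`. -/
def bowenBall (T : X → X) (n : ℕ) (x : X) (ε : ℝ) : Set X :=
  {y | ∀ j < n, dist (T^[j] x) (T^[j] y) < ε}

/-- `C`, regarded as the collection of the balls `B_m(x, ε)` with `(m, x) ∈ C`, is an at most
countable cover of `Z` by Bowen balls of length at least `n`. -/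
def IsBowenCover (T : X → X) (Z : Set X) (ε : ℝ) (n : ℕ) (C : Set (ℕ × X)) : Prop :=
  C.Countable ∧ (∀ p ∈ C, n ≤ p.1) ∧ Z ⊆ ⋃ p ∈ C, bowenBall T p.1 p.2 ε

/-- `H^s_n(Z, ε)`: the infimum of `∑_i exp(-s n_i)` over the covers of `Z` by Bowen balls
`B_{n_i}(x_i, ε)` with all `n_i ≥ n`. -/
def bowenPreMeasure (T : X → X) (s : ℝ≥0) (n : ℕ) (Z : Set X) (ε : ℝ) : ℝ≥0∞ :=
  ⨅ (C : Set (ℕ × X)) (_ : IsBowenCover T Z ε n C),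
    ∑' p : C, ENNReal.ofReal (Real.exp (-(s : ℝ) * (p.1.1 : ℝ)))

/-- `H^s(Z, ε) = lim_n H^s_n(Z, ε)`; the sequence is non-decreasing in `n`, so that the limit is the
supremum. -/
def bowenMeasure (T : X → X) (s : ℝ≥0) (Z : Set X) (ε : ℝ) : ℝ≥0∞ :=
  ⨆ n : ℕ, bowenPreMeasure T s n Z ε

/-- The critical value `h_top(Z, ε) ∈ [0, ∞]` at which `s ↦ H^s(Z, ε)`, `s ≥ 0`, drops from `∞`
to `0`. -/
def topEntropyAt (T : X → X) (Z : Set X) (ε : ℝ) : ℝ≥0∞ :=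
  ⨅ (s : ℝ≥0) (_ : bowenMeasure T s Z ε = 0), (s : ℝ≥0∞)

/-- Bowen's topological entropy `h_top(Z) = lim_{ε → 0} h_top(Z, ε)`; as `h_top(Z, ε)` does not
decrease when `ε` decreases, the limit is the supremum over `ε > 0`. -/
def topEntropy (T : X → X) (Z : Set X) : ℝ≥0∞ :=
  ⨆ (ε : ℝ) (_ : 0 < ε), topEntropyAt T Z ε

end TopologicalEntropy

/-! ### Measure-theoretic (Kolmogorov–Sinai) entropy -/

section MeasureEntropy

variable {X : Type*} [MeasurableSpace X]

/-- The Shannon entropy of `⋁_{j < n} T^{-j} ξ`, where the finite partition `ξ` is given by its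
labelling map `ξ : X → Fin k`: the atoms of the join are indexed by words of length `n`. -/
def joinEntropy (T : X → X) (μ : Measure X) {k : ℕ} (ξ : X → Fin k) (n : ℕ) : ℝ :=
  ∑ w : Fin n → Fin k, Real.negMulLog (μ.real {x | ∀ j : Fin n, ξ (T^[(j : ℕ)] x) = w j})

/-- `h_μ(T, ξ) = lim_n (1/n) H_μ(⋁_{j < n} T^{-j} ξ)`. For an invariant `μ` the limit exists and is
therefore the upper limit. -/
def partitionEntropy (T : X → X) (μ : Measure X) {k : ℕ} (ξ : X → Fin k) : ℝ≥0∞ :=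
  limsup (fun n : ℕ => ENNReal.ofReal (joinEntropy T μ ξ n / n)) atTop

/-- The entropy `h_μ`: the supremum of `h_μ(T, ξ)` over all finite measurable partitions `ξ`. -/
def measureEntropy (T : X → X) (μ : Measure X) : ℝ≥0∞ :=
  ⨆ (k : ℕ) (ξ : X → Fin k) (_ : Measurable ξ), partitionEntropy T μ ξ

end MeasureEntropy

/-! ### Invariant measures, generic points, saturated systems -/

section Saturated

variable {X : Type*} [MetricSpace X] [MeasurableSpace X] [BorelSpace X]

/-- The set of all `T`-invariant Borel probability measures. -/
def invariantMeasures (T : X → X) : Set (ProbabilityMeasure X) :=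
  {μ | MeasurePreserving T (μ : Measure X) (μ : Measure X)}

/-- The empirical measure `(1/(n+1)) ∑_{j=0}^{n} δ_{T^j x}` (the index is shifted by one so that it
is a probability measure for every `n`). -/
def empiricalMeasure (T : X → X) (x : X) (n : ℕ) : ProbabilityMeasure X :=
  ⟨((n + 1 : ℕ) : ℝ≥0∞)⁻¹ • ∑ j ∈ Finset.range (n + 1), Measure.dirac (T^[j] x), ⟨by
    simp only [Measure.smul_apply, Measure.finsetSum_apply, measure_univ, Finset.sum_const,
      Finset.card_range, nsmul_eq_mul, mul_one, smul_eq_mul]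
    exact ENNReal.inv_mul_cancel (by simp) (ENNReal.natCast_ne_top _)⟩⟩

/-- The set `G_μ` of `μ`-generic points; the topology on `ProbabilityMeasure X` is that of weak
(weak star) convergence. -/
def genericPoints (T : X → X) (μ : ProbabilityMeasure X) : Set X :=
  {x | Tendsto (empiricalMeasure T x) atTop (𝓝 μ)}

/-- `(X, T)` is saturated: `h_top(G_μ) = h_μ` for every invariant `μ`. -/
def IsSaturated (T : X → X) : Prop :=
  ∀ μ ∈ invariantMeasures T, topEntropy T (genericPoints T μ) = measureEntropy T (μ : Measure X)

end Saturated

/-! ### The Pettis integral of a weak star continuous function -/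

section Pettis

variable {X : Type*} [MetricSpace X]
  {B : Type*} [NormedAddCommGroup B] [NormedSpace ℝ B]

theorem continuous_pairing {Φ : X → WeakDual ℝ B} (hΦ : Continuous Φ) (w : B) :
    Continuous fun x => Φ x w :=
  (WeakDual.eval_continuous w).comp hΦ

variable [CompactSpace X]

theorem exists_pairing_bound [CompleteSpace B] {Φ : X → WeakDual ℝ B} (hΦ : Continuous Φ) :
    ∃ C : ℝ, ∀ x w, ‖Φ x w‖ ≤ C * ‖w‖ := by
  obtain ⟨C, hC⟩ := banach_steinhaus (g := fun x => WeakDual.toStrongDual (Φ x)) (fun w => by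
    obtain ⟨K, hK⟩ := (isCompact_range (continuous_pairing hΦ w)).isBounded.exists_norm_le
    exact ⟨K, fun x => hK _ ⟨x, rfl⟩⟩)
  exact ⟨C, fun x w => ((WeakDual.toStrongDual (Φ x)).le_opNorm w).trans
    (mul_le_mul_of_nonneg_right (hC x) (norm_nonneg w))⟩

variable [MeasurableSpace X] [BorelSpace X]

theorem integrable_pairing {Φ : X → WeakDual ℝ B} (hΦ : Continuous Φ)
    (μ : ProbabilityMeasure X) (w : B) : Integrable (fun x => Φ x w) (μ : Measure X) :=
  (continuous_pairing hΦ w).integrable_of_hasCompactSupport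
    (HasCompactSupport.of_compactSpace _)

/-- The Pettis integral `∫ Φ dμ ∈ B*`, that is, the functional `w ↦ ∫ ⟨Φ, w⟩ dμ`. -/
def pettisIntegral [CompleteSpace B] {Φ : X → WeakDual ℝ B} (hΦ : Continuous Φ)
    (μ : ProbabilityMeasure X) : WeakDual ℝ B :=
  StrongDual.toWeakDual <| LinearMap.mkContinuousOfExistsBound
    { toFun := fun w => ∫ x, Φ x w ∂(μ : Measure X)
      map_add' := fun v w => by
        simp only [map_add]
        exact integral_add (integrable_pairing hΦ μ v) (integrable_pairing hΦ μ w)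
      map_smul' := fun c w => by
        simp only [map_smul, smul_eq_mul, RingHom.id_apply]
        exact integral_const_mul c _ }
    (by
      obtain ⟨C, hC⟩ := exists_pairing_bound hΦ
      refine ⟨C, fun w => ?_⟩
      have h := norm_integral_le_of_norm_le_const (μ := (μ : Measure X))
        (Eventually.of_forall fun x => hC x w)
      simpa using h)

theorem pettisIntegral_apply [CompleteSpace B] {Φ : X → WeakDual ℝ B} (hΦ : Continuous Φ)
    (μ : ProbabilityMeasure X) (w : B) :
    pettisIntegral hΦ μ w = ∫ x, Φ x w ∂(μ : Measure X) := rfl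

end Pettis

/-! ### Level sets -/

section LevelSets

variable {X : Type*} [MetricSpace X] {B : Type*} [NormedAddCommGroup B] [NormedSpace ℝ B]
  {Y : Type*}

/-- The set of `x` with `lim_n Ψ(A_n Φ(x)) = β`, where `A_n Φ(x) = (1/n) ∑_{j<n} Φ(T^j x)`. -/
def levelSet [TopologicalSpace Y] (T : X → X) (Φ : X → WeakDual ℝ B) (Ψ : WeakDual ℝ B → Y)
    (β : Y) : Set X :=
  {x | Tendsto (fun n : ℕ => Ψ (birkhoffAverage ℝ T Φ n x)) atTop (𝓝 β)}

/-- The set of `x` for which `A_n Φ(x)` converges in the weak star topology, with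
`Ψ(lim_n A_n Φ(x)) = β`. -/
def limitLevelSet (T : X → X) (Φ : X → WeakDual ℝ B) (Ψ : WeakDual ℝ B → Y) (β : Y) : Set X :=
  {x | ∃ α : WeakDual ℝ B,
    Tendsto (fun n : ℕ => birkhoffAverage ℝ T Φ n x) atTop (𝓝 α) ∧ Ψ α = β}

/-- The set of invariant probability measures `μ` with `Ψ(∫ Φ dμ) = β`. -/
def measureLevelSet [CompactSpace X] [MeasurableSpace X] [BorelSpace X] [CompleteSpace B]
    (T : X → X) {Φ : X → WeakDual ℝ B} (hΦ : Continuous Φ) (Ψ : WeakDual ℝ B → Y) (β : Y) :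
    Set (ProbabilityMeasure X) :=
  {μ | μ ∈ invariantMeasures T ∧ Ψ (pettisIntegral hΦ μ) = β}

end LevelSets

end SaturatedSystem

end

/-!
If the empirical measures of `x` accumulate at `μ`, then `μ` is invariant and, along the same
subsequence, the averages `A_n Φ(x)` tend to `∫ Φ dμ`. So a point of the level set of `β` has an
accumulating `μ` with `Ψ(∫ Φ dμ) = β`, while conversely the generic points of such a `μ` lie in the
level set. By saturation the generic points give the lower bound.

The upper bound is Bowen's: if the empirical measures of the points of `Z` accumulate at invariant
measures of entropy less than `a`, then `h_top(Z) ≤ a`. Near such a `μ`, take a fine partition with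
`μ`-null boundary and a positive vector `q` on words of length `m` whose cross entropy relative to
`μ` is less than `m a`. The mean of `-log q` is continuous at `μ`, so the orbits of length `n` whose
empirical measure is close to `μ` can be cut, at a suitable offset, into blocks of length `m` of
total `q`-information at most `n a`; there are `O(exp(n a))` such block sequences. Countably many
of these neighbourhoods cover the measures involved, and each contributes measure zero by
Borel–Cantelli.
-/

namespace SaturatedSystem

section BowenMeasure

variable {X : Type*} [MetricSpace X] {T : X → X} {s : ℝ≥0} {ε : ℝ}

theorem bowenPreMeasure_mono_set {n : ℕ} {Z Z' : Set X} (h : Z ⊆ Z') :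
    bowenPreMeasure T s n Z ε ≤ bowenPreMeasure T s n Z' ε :=
  le_iInf₂ fun C hC => iInf₂_le C ⟨hC.1, hC.2.1, h.trans hC.2.2⟩

theorem bowenPreMeasure_mono_length {n n' : ℕ} {Z : Set X} (h : n ≤ n') :
    bowenPreMeasure T s n Z ε ≤ bowenPreMeasure T s n' Z ε :=
  le_iInf₂ fun C hC => iInf₂_le C ⟨hC.1, fun p hp => h.trans (hC.2.1 p hp), hC.2.2⟩

theorem bowenMeasure_mono_set {Z Z' : Set X} (h : Z ⊆ Z') :
    bowenMeasure T s Z ε ≤ bowenMeasure T s Z' ε :=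
  iSup_mono fun _ => bowenPreMeasure_mono_set h

theorem topEntropyAt_le {Z : Set X} (h : bowenMeasure T s Z ε = 0) : topEntropyAt T Z ε ≤ s :=
  iInf₂_le (f := fun (s : ℝ≥0) _ => (s : ℝ≥0∞)) s h

theorem topEntropy_mono {Z Z' : Set X} (h : Z ⊆ Z') : topEntropy T Z ≤ topEntropy T Z' :=
  iSup₂_mono fun _ _ => le_iInf₂ fun _ hs =>
    topEntropyAt_le (le_antisymm ((bowenMeasure_mono_set h).trans hs.le) zero_le)

theorem IsBowenCover.iUnion {ι : Type*} [Countable ι] {n : ℕ} {Z : ι → Set X}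
    {C : ι → Set (ℕ × X)} (hC : ∀ i, IsBowenCover T (Z i) ε n (C i)) :
    IsBowenCover T (⋃ i, Z i) ε n (⋃ i, C i) := by
  refine ⟨countable_iUnion fun i => (hC i).1, fun p hp => ?_, iUnion_subset fun i => ?_⟩
  · obtain ⟨i, hi⟩ := mem_iUnion.1 hp
    exact (hC i).2.1 p hi
  · exact (hC i).2.2.trans (biUnion_mono (subset_iUnion C i) fun _ _ => Subset.rfl)

theorem bowenPreMeasure_iUnion_le {ι : Type*} [Countable ι] {n : ℕ} (Z : ι → Set X) :
    bowenPreMeasure T s n (⋃ i, Z i) ε ≤ ∑' i, bowenPreMeasure T s n (Z i) ε := by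
  let weight : ℕ × X → ℝ≥0∞ := fun p => ENNReal.ofReal (Real.exp (-(s : ℝ) * (p.1 : ℝ)))
  refine ENNReal.le_of_forall_pos_le_add fun η hη hfin => ?_
  obtain ⟨δ, hδ, hδη⟩ := ENNReal.exists_pos_sum_of_countable (ENNReal.coe_pos.2 hη).ne' ι
  have hcover (i : ι) : ∃ C, IsBowenCover T (Z i) ε n C ∧
      ∑' p : C, weight p < bowenPreMeasure T s n (Z i) ε + δ i := by
    have := ENNReal.lt_add_right (ENNReal.ne_top_of_tsum_ne_top hfin.ne i)
      (ENNReal.coe_pos.2 (hδ i)).ne'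
    simpa only [bowenPreMeasure, iInf_lt_iff, exists_prop] using this
  choose C hC hCδ using hcover
  calc bowenPreMeasure T s n (⋃ i, Z i) ε
      ≤ ∑' p : ⋃ i, C i, weight p := iInf₂_le _ (IsBowenCover.iUnion hC)
    _ ≤ ∑' i, ∑' p : C i, weight p := ENNReal.tsum_iUnion_le_tsum weight C
    _ ≤ ∑' i, (bowenPreMeasure T s n (Z i) ε + δ i) := ENNReal.tsum_le_tsum fun i => (hCδ i).le
    _ ≤ ∑' i, bowenPreMeasure T s n (Z i) ε + η := by
        rw [ENNReal.tsum_add]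
        gcongr

theorem bowenMeasure_iUnion_le {ι : Type*} [Countable ι] (Z : ι → Set X) :
    bowenMeasure T s (⋃ i, Z i) ε ≤ ∑' i, bowenMeasure T s (Z i) ε :=
  iSup_le fun n => (bowenPreMeasure_iUnion_le Z).trans
    (ENNReal.tsum_le_tsum fun i => le_iSup (fun n => bowenPreMeasure T s n (Z i) ε) n)

theorem bowenMeasure_limsup_eq_zero {V : ℕ → Set X}
    (hV : ∑' n, bowenPreMeasure T s n (V n) ε ≠ ∞) :
    bowenMeasure T s (limsup V atTop) ε = 0 := by
  have htail (M : ℕ) : bowenPreMeasure T s M (limsup V atTop) ε ≤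
      ∑' n, bowenPreMeasure T s (n + M) (V (n + M)) ε :=
    calc bowenPreMeasure T s M (limsup V atTop) ε
        ≤ bowenPreMeasure T s M (⋃ n, V (n + M)) ε := by
          rw [limsup_eq_iInf_iSup_of_nat']
          exact bowenPreMeasure_mono_set (iInf_le _ M)
      _ ≤ ∑' n, bowenPreMeasure T s M (V (n + M)) ε := bowenPreMeasure_iUnion_le _
      _ ≤ ∑' n, bowenPreMeasure T s (n + M) (V (n + M)) ε :=
          ENNReal.tsum_le_tsum fun n => bowenPreMeasure_mono_length (Nat.le_add_left M n)
  refine le_antisymm (iSup_le fun N => ?_) zero_le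
  refine ge_of_tendsto (ENNReal.tendsto_sum_nat_add _ hV) ?_
  filter_upwards [eventually_ge_atTop N] with M hM
  exact (bowenPreMeasure_mono_length hM).trans (htail M)

/-- `Z` is covered by at most `N` Bowen balls of length `n` and radius `ε`. This bounds the
`(n, ε)`-covering number of `Z`; `N` is real so that it can be an exponential in `n`. -/
def CoveredByBowenBalls (T : X → X) (n : ℕ) (Z : Set X) (ε N : ℝ) : Prop :=
  ∃ F : Finset X, (F.card : ℝ) ≤ N ∧ Z ⊆ ⋃ x ∈ F, bowenBall T n x ε

theorem CoveredByBowenBalls.mono {n : ℕ} {Z Z' : Set X} {N : ℝ}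
    (h : CoveredByBowenBalls T n Z' ε N) (hZ : Z ⊆ Z') : CoveredByBowenBalls T n Z ε N :=
  let ⟨F, hFN, hF⟩ := h
  ⟨F, hFN, hZ.trans hF⟩

theorem CoveredByBowenBalls.bowenPreMeasure_le {n : ℕ} {Z : Set X} {N : ℝ}
    (h : CoveredByBowenBalls T n Z ε N) (s : ℝ≥0) :
    bowenPreMeasure T s n Z ε ≤ ENNReal.ofReal (N * Real.exp (-(s : ℝ) * n)) := by
  obtain ⟨F, hFN, hF⟩ := h
  have hcover : IsBowenCover T Z ε n (({n} ×ˢ F : Finset (ℕ × X)) : Set (ℕ × X)) := by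
    refine ⟨Finset.countable_toSet _, fun p hp => ?_, fun x hx => ?_⟩
    · simp only [Finset.coe_product, Finset.coe_singleton, mem_prod, mem_singleton_iff] at hp
      exact hp.1.ge
    · obtain ⟨y, hy, hxy⟩ := mem_iUnion₂.1 (hF hx)
      exact mem_iUnion₂.2 ⟨(n, y), by simpa using hy, hxy⟩
  refine (iInf₂_le _ hcover).trans ?_
  rw [Finset.tsum_subtype' _ fun p : ℕ × X => ENNReal.ofReal (Real.exp (-(s : ℝ) * (p.1 : ℝ)))]
  simp only [Finset.sum_product, Finset.sum_singleton, Finset.sum_const, nsmul_eq_mul]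
  rw [← ENNReal.ofReal_natCast, ← ENNReal.ofReal_mul (Nat.cast_nonneg _)]
  gcongr

theorem bowenMeasure_limsup_eq_zero_of_coveredByBowenBalls {a K : ℝ} (has : a < s)
    {V : ℕ → Set X}
    (hV : ∀ n, CoveredByBowenBalls T (n + 1) (V n) ε (K * Real.exp (a * (n + 1 : ℕ)))) :
    bowenMeasure T s (limsup V atTop) ε = 0 := by
  have hgeom (n : ℕ) : bowenPreMeasure T s n (V n) ε ≤
      ENNReal.ofReal (K * Real.exp (a - s) ^ (n + 1)) := by
    refine (bowenPreMeasure_mono_length n.le_succ).trans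
      (((hV n).bowenPreMeasure_le s).trans_eq ?_)
    rw [mul_assoc, ← Real.exp_add, ← Real.exp_nat_mul]
    ring_nf
  have hsum : Summable fun n : ℕ => K * Real.exp (a - s) ^ (n + 1) :=
    ((summable_nat_add_iff 1).2 (summable_geometric_of_lt_one (Real.exp_pos _).le
      (Real.exp_lt_one_iff.2 (sub_neg.2 has)))).mul_left K
  exact bowenMeasure_limsup_eq_zero
    (ne_top_of_le_ne_top hsum.tsum_ofReal_ne_top (ENNReal.tsum_le_tsum hgeom))

end BowenMeasure

section Coding

theorem sum_range_sum_range_add_mul {M : Type*} [AddCommMonoid M] (f : ℕ → M) (m L : ℕ) :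
    ∑ r ∈ Finset.range m, ∑ i ∈ Finset.range L, f (r + i * m) =
      ∑ j ∈ Finset.range (L * m), f j := by
  induction L with
  | zero => simp
  | succ L ih =>
    simp only [Finset.sum_range_succ, Finset.sum_add_distrib, ih, Nat.succ_mul,
      Finset.sum_range_add]
    simp only [add_comm (L * m)]

theorem exists_mul_sum_range_add_mul_le {f : ℕ → ℝ} (hf : ∀ j, 0 ≤ f j) {m : ℕ} (hm : 0 < m)
    (n : ℕ) :
    ∃ r < m, m * ∑ i ∈ Finset.range (n / m), f (r + i * m) ≤ ∑ j ∈ Finset.range n, f j := by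
  have hsum : ∑ r ∈ Finset.range m, m * ∑ i ∈ Finset.range (n / m), f (r + i * m) ≤
      ∑ _r ∈ Finset.range m, ∑ j ∈ Finset.range n, f j := by
    rw [← Finset.mul_sum, sum_range_sum_range_add_mul, Finset.sum_const, Finset.card_range,
      nsmul_eq_mul]
    gcongr
    · exact fun j _ _ => hf j
    · exact Nat.div_mul_le_self n m
  obtain ⟨r, hr, hle⟩ := Finset.exists_le_of_sum_le (Finset.nonempty_range_iff.2 hm.ne') hsum
  exact ⟨r, Finset.mem_range.1 hr, hle⟩

theorem exists_finset_card_le_of_mapsTo {X ι : Type*} {code : X → ι} {V : Set X} {G : Finset ι}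
    (h : MapsTo code V G) :
    ∃ F : Finset X, F.card ≤ G.card ∧ ∀ x ∈ V, ∃ y ∈ F, code y = code x := by
  obtain ⟨S, hSV, hS⟩ := exists_subset_bijOn V code
  have hSG : MapsTo code S G := h.mono_left hSV
  lift S to Finset X using Finite.of_injOn hSG hS.injOn G.finite_toSet
  exact ⟨S, Finset.card_le_card_of_injOn code hSG hS.injOn,
    fun x hx => hS.surjOn (mem_image_of_mem code hx)⟩

-- The weights `∏ i, q (b i)` of all words add up to at most `1`.
theorem card_sum_neg_log_le_le_exp {ι W : Type*} [Fintype ι] [DecidableEq ι] [Fintype W]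
    {q : W → ℝ} (hq0 : ∀ w, 0 < q w) (hq1 : ∑ w, q w ≤ 1) (t : ℝ) :
    ((Finset.univ.filter fun b : ι → W => ∑ i, -Real.log (q (b i)) ≤ t).card : ℝ) ≤
      Real.exp t := by
  set G := Finset.univ.filter fun b : ι → W => ∑ i, -Real.log (q (b i)) ≤ t
  have hweight : ∀ b ∈ G, Real.exp (-t) ≤ ∏ i, q (b i) := fun b hb => by
    have hb : ∑ i, -Real.log (q (b i)) ≤ t := (Finset.mem_filter.1 hb).2
    rw [← Real.le_log_iff_exp_le (Finset.prod_pos fun i _ => hq0 _),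
      Real.log_prod fun i _ => (hq0 _).ne']
    rw [Finset.sum_neg_distrib] at hb
    exact neg_le.1 hb
  have hmass : G.card * Real.exp (-t) ≤ 1 :=
    calc G.card * Real.exp (-t) = ∑ _b ∈ G, Real.exp (-t) := by simp
      _ ≤ ∑ b ∈ G, ∏ i, q (b i) := Finset.sum_le_sum hweight
      _ ≤ ∑ b : ι → W, ∏ i, q (b i) := Finset.sum_le_univ_sum_of_nonneg
          fun b => Finset.prod_nonneg fun i _ => (hq0 _).le
      _ = ∏ _i : ι, ∑ w, q w := (Fintype.prod_sum fun (_ : ι) w => q w).symm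
      _ ≤ 1 := Finset.prod_le_one (fun _ _ => Finset.sum_nonneg fun w _ => (hq0 w).le)
          fun _ _ => hq1
  rwa [Real.exp_neg, ← div_eq_mul_inv, div_le_one (Real.exp_pos t)] at hmass

variable {X A : Type*} {T : X → X} {ξ : X → A}

/-- The word of length `m` read off along the orbit of `x` by the labelling `ξ`: the atom of
`⋁_{j < m} T^{-j} ξ` that contains `x`. -/
def orbitWord (T : X → X) (ξ : X → A) (m : ℕ) (x : X) : Fin m → A :=
  fun j => ξ (T^[(j : ℕ)] x)

/-- The words of length `m` of `x` at times `0`, `L m` and `r + i m` for `i < L`. For `r < m` the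
`L` consecutive blocks starting at `r` miss fewer than `m` times at the start and at most `m` at the
end of `[0, (L + 1) m)`, which the first two words make up for. -/
def blockCode (T : X → X) (ξ : X → A) (m L r : ℕ) (x : X) :
    ((Fin m → A) × (Fin m → A)) × (Fin L → Fin m → A) :=
  ((orbitWord T ξ m x, orbitWord T ξ m (T^[L * m] x)),
    fun i => orbitWord T ξ m (T^[r + i * m] x))

theorem apply_iterate_eq_of_orbitWord_eq {m t j : ℕ} {x y : X}
    (h : orbitWord T ξ m (T^[t] x) = orbitWord T ξ m (T^[t] y)) (htj : t ≤ j) (hjt : j < t + m) :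
    ξ (T^[j] x) = ξ (T^[j] y) := by
  have := congrFun h ⟨j - t, by lia⟩
  simpa only [orbitWord, ← Function.iterate_add_apply, Nat.sub_add_cancel htj] using this

theorem apply_iterate_eq_of_blockCode_eq {m L r : ℕ} (hr : r < m) {x y : X}
    (h : blockCode T ξ m L r x = blockCode T ξ m L r y) {j : ℕ} (hj : j < (L + 1) * m) :
    ξ (T^[j] x) = ξ (T^[j] y) := by
  obtain ⟨⟨hfirst, hlast⟩, hblocks⟩ : (orbitWord T ξ m x = orbitWord T ξ m y ∧
      orbitWord T ξ m (T^[L * m] x) = orbitWord T ξ m (T^[L * m] y)) ∧ ∀ i : Fin L,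
        orbitWord T ξ m (T^[r + i * m] x) = orbitWord T ξ m (T^[r + i * m] y) := by
    simpa only [blockCode, Prod.mk.injEq, funext_iff] using h
  rcases lt_or_ge j m with hjm | hjm
  · exact apply_iterate_eq_of_orbitWord_eq (t := 0) hfirst j.zero_le (by lia)
  rcases le_or_gt (L * m) j with hjL | hjL
  · exact apply_iterate_eq_of_orbitWord_eq hlast hjL (by linarith)
  · have hm : 0 < m := by lia
    have hdivmod := Nat.div_add_mod' (j - r) m
    have hmod := Nat.mod_lt (j - r) hm
    have hi : (j - r) / m < L := (Nat.div_lt_iff_lt_mul hm).2 (by lia)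
    exact apply_iterate_eq_of_orbitWord_eq (hblocks ⟨_, hi⟩) (by grind) (by grind)

theorem coveredByBowenBalls_of_birkhoffSum_le [MetricSpace X] [Fintype A] {ε : ℝ}
    (hξ : ∀ x y, ξ x = ξ y → dist x y < ε) {m : ℕ} (hm : 0 < m) {q : (Fin m → A) → ℝ}
    (hq0 : ∀ w, 0 < q w) (hq1 : ∑ w, q w ≤ 1) (n : ℕ) (t : ℝ) :
    CoveredByBowenBalls T n
      {x | birkhoffSum T (fun y => -Real.log (q (orbitWord T ξ m y))) n x ≤ m * t} ε
      (m * (Fintype.card (Fin m → A)) ^ 2 * Real.exp t) := by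
  classical
  set info : X → ℝ := fun y => -Real.log (q (orbitWord T ξ m y))
  set Z : Set X := {x | birkhoffSum T info n x ≤ m * t}
  set L := n / m
  have hinfo (y : X) : 0 ≤ info y := neg_nonneg.2 <| Real.log_nonpos (hq0 _).le <|
    (Finset.single_le_sum (fun w _ => (hq0 w).le) (Finset.mem_univ _)).trans hq1
  have hoffset (x : X) : ∃ r < m, x ∈ Z → ∑ i : Fin L, info (T^[r + i * m] x) ≤ t := by
    obtain ⟨r, hr, hle⟩ := exists_mul_sum_range_add_mul_le (fun j => hinfo (T^[j] x)) hm n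
    refine ⟨r, hr, fun hx => le_of_mul_le_mul_left (hle.trans' ?_ |>.trans hx) (by positivity)⟩
    rw [Finset.sum_range fun i => info (T^[r + i * m] x)]
  choose r hrm hr using hoffset
  let G : Finset (ℕ × ((Fin m → A) × (Fin m → A)) × (Fin L → Fin m → A)) :=
    Finset.range m ×ˢ Finset.univ ×ˢ
      Finset.univ.filter fun b : Fin L → Fin m → A => ∑ i, -Real.log (q (b i)) ≤ t
  have hG : (G.card : ℝ) ≤ m * (Fintype.card (Fin m → A)) ^ 2 * Real.exp t := by
    rw [Finset.card_product, Finset.card_product, Finset.card_range, Finset.card_univ,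
      Fintype.card_prod, Nat.cast_mul, Nat.cast_mul, Nat.cast_mul, ← sq, ← mul_assoc]
    gcongr
    exact card_sum_neg_log_le_le_exp hq0 hq1 t
  have hcode : MapsTo (fun x => (r x, blockCode T ξ m L (r x) x)) Z G := fun x hx => by
    simpa [G, blockCode, hrm x, info] using hr x hx
  obtain ⟨F, hFG, hF⟩ := exists_finset_card_le_of_mapsTo hcode
  refine ⟨F, (Nat.cast_le.2 hFG).trans hG, fun x hx => ?_⟩
  obtain ⟨y, hyF, hyx⟩ := hF x hx
  obtain ⟨hoff, hblock⟩ := Prod.mk.inj hyx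
  refine mem_iUnion₂.2 ⟨y, hyF, fun j hj => hξ _ _ ?_⟩
  rw [hoff] at hblock
  exact apply_iterate_eq_of_blockCode_eq (hrm x) hblock
    (hj.trans ((Nat.div_lt_iff_lt_mul hm).1 (Nat.lt_succ_self L)))

end Coding

section NullFrontier

theorem frontier_preimage_singleton_pi_subset {X ι : Type*} {A : ι → Type*} [TopologicalSpace X]
    [Finite ι] (g : X → ∀ i, A i) (w : ∀ i, A i) :
    frontier (g ⁻¹' {w}) ⊆ ⋃ i, frontier ((fun x => g x i) ⁻¹' {w i}) := by
  have hpre : g ⁻¹' {w} = ⋂ i, (fun x => g x i) ⁻¹' {w i} := by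
    ext x
    simp [funext_iff]
  intro x hx
  rw [hpre, frontier, interior_iInter_of_finite] at hx
  obtain ⟨i, hi⟩ : ∃ i, x ∉ interior ((fun x => g x i) ⁻¹' {w i}) := by simpa using hx.2
  exact mem_iUnion.2 ⟨i, closure_mono (iInter_subset _ i) hx.1, hi⟩

theorem measure_frontier_preimage_singleton_prop {X : Type*} [TopologicalSpace X]
    [MeasurableSpace X] {μ : Measure X} {s : Set X} (hs : μ (frontier s) = 0) (p : Prop) :
    μ (frontier ((fun x => x ∈ s) ⁻¹' {p})) = 0 := by
  by_cases hp : p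
  · simpa [hp, preimage] using hs
  · rw [← frontier_compl] at hs
    simpa [hp, preimage, compl_def] using hs

theorem exists_partition_null_frontier {X : Type*} [PseudoMetricSpace X] [CompactSpace X]
    [MeasurableSpace X] [OpensMeasurableSpace X] (μ : Measure X) [SFinite μ] {ε : ℝ}
    (hε : 0 < ε) : ∃ (k : ℕ) (ξ : X → Fin k), Measurable ξ ∧ (∀ x y, ξ x = ξ y → dist x y < ε) ∧
      ∀ i, μ (frontier (ξ ⁻¹' {i})) = 0 := by
  classical
  choose r hr hμr using fun x : X => exists_null_frontier_thickening μ {x} (half_pos hε)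
  simp only [Metric.thickening_singleton] at hμr
  obtain ⟨t, ht⟩ := isCompact_univ.elim_finite_subcover (fun x => Metric.ball x (r x))
    (fun x => Metric.isOpen_ball)
    (fun x _ => mem_iUnion.2 ⟨x, Metric.mem_ball_self (hr x).1⟩)
  let ζ : X → t → Prop := fun x c => x ∈ Metric.ball (c : X) (r c)
  let e := Fintype.equivFin (t → Prop)
  refine ⟨_, fun x => e (ζ x), ?_, fun x y hxy => ?_, fun i => ?_⟩
  · exact Measurable.of_discrete.comp
      (measurable_pi_lambda _ fun c => measurableSet_setOfPred.1 measurableSet_ball)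
  · obtain ⟨c, hc, hxc⟩ := mem_iUnion₂.1 (ht (mem_univ x))
    have hyc : y ∈ Metric.ball c (r c) := (congrFun (e.injective hxy) ⟨c, hc⟩).mp hxc
    calc dist x y ≤ dist x c + dist y c := dist_triangle_right x y c
      _ < ε / 2 + ε / 2 := add_lt_add (hxc.trans (hr c).2) (hyc.trans (hr c).2)
      _ = ε := add_halves ε
  · have hpre : (fun x => e (ζ x)) ⁻¹' {i} = ζ ⁻¹' {e.symm i} := by
      ext x
      simp [Equiv.eq_symm_apply]
    rw [hpre]
    exact measure_mono_null (frontier_preimage_singleton_pi_subset ζ _)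
      (measure_iUnion_null fun c => measure_frontier_preimage_singleton_prop (hμr c) _)

theorem measure_frontier_orbitWord_preimage {X A : Type*} [TopologicalSpace X] [MeasurableSpace X]
    [OpensMeasurableSpace X] {T : X → X} (hT : Continuous T) {μ : Measure X}
    (hμ : MeasurePreserving T μ μ) {ξ : X → A} (hξ : ∀ i, μ (frontier (ξ ⁻¹' {i})) = 0)
    {m : ℕ} (w : Fin m → A) : μ (frontier (orbitWord T ξ m ⁻¹' {w})) = 0 := by
  refine measure_mono_null (frontier_preimage_singleton_pi_subset _ w)
    (measure_iUnion_null fun j => ?_)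
  refine measure_mono_null ((hT.iterate j).frontier_preimage_subset (ξ ⁻¹' {w j})) ?_
  rw [(hμ.iterate j).measure_preimage isClosed_frontier.measurableSet.nullMeasurableSet]
  exact hξ _

theorem integral_comp_eq_sum_preimage_singleton {X W E : Type*} [MeasurableSpace X] [Fintype W]
    [MeasurableSpace W] [MeasurableSingletonClass W] [NormedAddCommGroup E] [NormedSpace ℝ E]
    [CompleteSpace E] {μ : Measure X} [IsFiniteMeasure μ] {g : X → W} (hg : Measurable g)
    (c : W → E) : ∫ x, c (g x) ∂μ = ∑ w, μ.real (g ⁻¹' {w}) • c w := by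
  rw [← integral_map_of_stronglyMeasurable hg .of_discrete, integral_fintype .of_finite]
  simp only [map_measureReal_apply hg (measurableSet_singleton _)]

theorem tendsto_integral_comp_of_null_frontier {X W E : Type*} [TopologicalSpace X]
    [MeasurableSpace X] [OpensMeasurableSpace X] [HasOuterApproxClosed X] [Finite W]
    [MeasurableSpace W] [MeasurableSingletonClass W] [NormedAddCommGroup E] [NormedSpace ℝ E]
    [CompleteSpace E] {μ : ProbabilityMeasure X} {g : X → W} (hg : Measurable g)
    (hμ : ∀ w, (μ : Measure X) (frontier (g ⁻¹' {w})) = 0) (c : W → E) :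
    Tendsto (fun ν : ProbabilityMeasure X => ∫ x, c (g x) ∂(ν : Measure X)) (𝓝 μ)
      (𝓝 (∫ x, c (g x) ∂(μ : Measure X))) := by
  have := Fintype.ofFinite W
  simp only [integral_comp_eq_sum_preimage_singleton hg]
  exact tendsto_finsetSum _ fun w _ => Tendsto.smul_const
    ((ENNReal.tendsto_toReal (measure_ne_top _ _)).comp
      (ProbabilityMeasure.tendsto_measure_of_null_frontier_of_tendsto' tendsto_id (hμ w))) _

end NullFrontier

section CrossEntropy

theorem mul_neg_log_div_le {p δ D : ℝ} (hp : 0 ≤ p) (hδ : 0 ≤ δ) (hD : 0 < D) :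
    p * -Real.log ((p + δ) / D) ≤ Real.negMulLog p + p * (D - 1) := by
  rcases hp.eq_or_lt with rfl | hp
  · simp
  have hlogp : Real.log p ≤ Real.log (p + δ) := Real.log_le_log hp (by linarith)
  have hlogD : Real.log D ≤ D - 1 := Real.log_le_sub_one_of_pos hD
  calc p * -Real.log ((p + δ) / D) = p * (-Real.log (p + δ) + Real.log D) := by
        rw [Real.log_div (by linarith) hD.ne']
        ring
    _ ≤ p * (-Real.log p + (D - 1)) := by gcongr
    _ = Real.negMulLog p + p * (D - 1) := by rw [Real.negMulLog]; ring

theorem exists_pos_crossEntropy_lt {W : Type*} [Fintype W] {p : W → ℝ} (hp0 : ∀ w, 0 ≤ p w)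
    (hp1 : ∑ w, p w = 1) {c : ℝ} (hc : ∑ w, Real.negMulLog (p w) < c) :
    ∃ q : W → ℝ, (∀ w, 0 < q w) ∧ ∑ w, q w = 1 ∧ ∑ w, p w * -Real.log (q w) < c := by
  obtain ⟨η, hη, hηc⟩ := exists_pos_mul_lt (sub_pos.2 hc) (Fintype.card W : ℝ)
  set D : ℝ := 1 + Fintype.card W * η with hDdef
  have hD : 0 < D := by positivity
  refine ⟨fun w => (p w + η) / D, fun w => div_pos (add_pos_of_nonneg_of_pos (hp0 w) hη) hD,
    ?_, ?_⟩
  · rw [← Finset.sum_div, Finset.sum_add_distrib, hp1, Finset.sum_const, Finset.card_univ,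
      nsmul_eq_mul, div_self hD.ne']
  · calc ∑ w, p w * -Real.log ((p w + η) / D)
        ≤ ∑ w, (Real.negMulLog (p w) + p w * (D - 1)) :=
          Finset.sum_le_sum fun w _ => mul_neg_log_div_le (hp0 w) hη.le hD
      _ = ∑ w, Real.negMulLog (p w) + (D - 1) := by
          rw [Finset.sum_add_distrib, ← Finset.sum_mul, hp1, one_mul]
      _ < c := by
          rw [hDdef, add_sub_cancel_left]
          exact lt_sub_iff_add_lt'.1 hηc

variable {X : Type*} [MeasurableSpace X] {T : X → X} {μ : Measure X} {k : ℕ} {ξ : X → Fin k}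

theorem measurable_orbitWord {A : Type*} [MeasurableSpace A] {ξ : X → A} (hT : Measurable T)
    (hξ : Measurable ξ) (m : ℕ) : Measurable (orbitWord T ξ m) :=
  measurable_pi_lambda _ fun j => hξ.comp (hT.iterate j)

theorem joinEntropy_eq_sum_negMulLog_preimage (m : ℕ) :
    joinEntropy T μ ξ m = ∑ w, Real.negMulLog (μ.real (orbitWord T ξ m ⁻¹' {w})) := by
  simp only [joinEntropy, orbitWord, preimage, mem_singleton_iff, funext_iff]

theorem joinEntropy_nonneg [IsProbabilityMeasure μ] (m : ℕ) : 0 ≤ joinEntropy T μ ξ m :=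
  Finset.sum_nonneg fun _ _ => Real.negMulLog_nonneg measureReal_nonneg measureReal_le_one

theorem exists_joinEntropy_lt [IsProbabilityMeasure μ] (hξ : Measurable ξ) {a : ℝ≥0}
    (ha : measureEntropy T μ < a) : ∃ m : ℕ, 0 < m ∧ joinEntropy T μ ξ m < m * a := by
  have hpart : partitionEntropy T μ ξ < a :=
    (le_iSup_of_le k (le_iSup₂_of_le (f := fun ξ _ => partitionEntropy T μ ξ) ξ hξ le_rfl)).trans_lt
      ha
  obtain ⟨m, hlt, hm⟩ := ((eventually_lt_of_limsup_lt hpart).and (eventually_gt_atTop 0)).exists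
  refine ⟨m, hm, ?_⟩
  rwa [← ENNReal.ofReal_coe_nnreal, ENNReal.ofReal_lt_ofReal_iff_of_nonneg
    (div_nonneg (joinEntropy_nonneg m) m.cast_nonneg), div_lt_iff₀' (Nat.cast_pos.2 hm)] at hlt

theorem exists_integral_neg_log_orbitWord_lt [IsProbabilityMeasure μ] (hT : Measurable T)
    (hξ : Measurable ξ) {a : ℝ≥0} (ha : measureEntropy T μ < a) :
    ∃ m : ℕ, 0 < m ∧ ∃ q : (Fin m → Fin k) → ℝ, (∀ w, 0 < q w) ∧ ∑ w, q w = 1 ∧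
      ∫ x, -Real.log (q (orbitWord T ξ m x)) ∂μ < m * a := by
  obtain ⟨m, hm, hlt⟩ := exists_joinEntropy_lt hξ ha
  have hword := measurable_orbitWord hT hξ m
  have hmass : ∑ w, μ.real (orbitWord T ξ m ⁻¹' {w}) = 1 := by
    simpa using (integral_comp_eq_sum_preimage_singleton (μ := μ) hword fun _ => (1 : ℝ)).symm
  rw [joinEntropy_eq_sum_negMulLog_preimage] at hlt
  obtain ⟨q, hq0, hq1, hq⟩ := exists_pos_crossEntropy_lt (fun w => measureReal_nonneg) hmass hlt
  refine ⟨m, hm, q, hq0, hq1, ?_⟩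
  rwa [integral_comp_eq_sum_preimage_singleton hword fun w => -Real.log (q w)]

end CrossEntropy

section EmpiricalMeasure

theorem birkhoffAverage_comp_self (R : Type*) {X E : Type*} [DivisionSemiring R]
    [AddCommMonoid E] [Module R E] (T : X → X) (g : X → E) (n : ℕ) (x : X) :
    birkhoffAverage R T (g ∘ T) n x = birkhoffAverage R T g n (T x) := by
  simp only [birkhoffAverage, birkhoffSum, Function.comp_apply, ← Function.iterate_succ_apply,
    ← Function.iterate_succ_apply']

theorem integral_empiricalMeasure {X E : Type*} [MeasurableSpace X] [NormedAddCommGroup E]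
    [NormedSpace ℝ E] [CompleteSpace E] {T : X → X} {g : X → E} (hg : StronglyMeasurable g)
    (x : X) (n : ℕ) :
    ∫ y, g y ∂(empiricalMeasure T x n : Measure X) = birkhoffAverage ℝ T g (n + 1) x := by
  change ∫ y, g y ∂(((n + 1 : ℕ) : ℝ≥0∞)⁻¹ •
    ∑ j ∈ Finset.range (n + 1), Measure.dirac (T^[j] x)) = _
  rw [integral_smul_measure, integral_finsetSum_measure fun j _ => integrable_dirac' hg (by simp)]
  simp only [integral_dirac' _ _ hg, ENNReal.toReal_inv, ENNReal.toReal_natCast, birkhoffAverage,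
    birkhoffSum]

theorem mem_invariantMeasures_of_tendsto {X ι : Type*} [TopologicalSpace X]
    [HasOuterApproxClosed X] [MeasurableSpace X] [BorelSpace X] {T : X → X} (hT : Continuous T)
    {x : X} {l : Filter ι} [l.NeBot] {φ : ι → ℕ} (hφ : Tendsto φ l atTop)
    {μ : ProbabilityMeasure X} (hμ : Tendsto (fun i => empiricalMeasure T x (φ i)) l (𝓝 μ)) :
    μ ∈ invariantMeasures T := by
  refine ⟨hT.measurable, ?_⟩
  have := Measure.isProbabilityMeasure_map (μ := (μ : Measure X)) hT.measurable.aemeasurable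
  refine ext_of_forall_integral_eq_of_IsFiniteMeasure fun g => ?_
  rw [integral_map hT.measurable.aemeasurable g.continuous.aestronglyMeasurable]
  rw [ProbabilityMeasure.tendsto_iff_forall_integral_tendsto] at hμ
  refine sub_eq_zero.1 (tendsto_nhds_unique ((hμ (g.compContinuous ⟨T, hT⟩)).sub (hμ g)) ?_)
  have hdiff : Tendsto (fun i => birkhoffAverage ℝ T g (φ i + 1) (T x) -
      birkhoffAverage ℝ T g (φ i + 1) x) l (𝓝 0) :=
    (tendsto_birkhoffAverage_apply_sub_birkhoffAverage' ℝ g.isBounded_range T x).comp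
      ((tendsto_add_atTop_nat 1).comp hφ)
  refine hdiff.congr fun i => ?_
  rw [integral_empiricalMeasure (g.compContinuous ⟨T, hT⟩).continuous.stronglyMeasurable,
    integral_empiricalMeasure g.continuous.stronglyMeasurable, ← birkhoffAverage_comp_self]
  rfl

theorem exists_tendsto_empiricalMeasure {X : Type*} [MetricSpace X] [MeasurableSpace X]
    [BorelSpace X] [CompactSpace X] {T : X → X} (hT : Continuous T) (x : X) :
    ∃ μ ∈ invariantMeasures T, ∃ φ : ℕ → ℕ, StrictMono φ ∧
      Tendsto (fun n => empiricalMeasure T x (φ n)) atTop (𝓝 μ) := by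
  obtain ⟨μ, -, φ, hφ, hμ⟩ := isCompact_univ.tendsto_subseq
    (x := empiricalMeasure T x) fun _ => mem_univ _
  exact ⟨μ, mem_invariantMeasures_of_tendsto hT hφ.tendsto_atTop hμ, φ, hφ, hμ⟩

end EmpiricalMeasure

section UpperBound

variable {X : Type*} [MetricSpace X] [CompactSpace X] [MeasurableSpace X] [BorelSpace X]
  {T : X → X}

theorem exists_nhds_coveredByBowenBalls (hT : Continuous T) {μ : ProbabilityMeasure X}
    (hμ : μ ∈ invariantMeasures T) {a : ℝ≥0} (ha : measureEntropy T (μ : Measure X) < a)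
    {ε : ℝ} (hε : 0 < ε) :
    ∃ U ∈ 𝓝 μ, ∃ K : ℝ, ∀ n, CoveredByBowenBalls T (n + 1) {x | empiricalMeasure T x n ∈ U} ε
      (K * Real.exp (a * (n + 1 : ℕ))) := by
  obtain ⟨k, ξ, hξ, hξε, hξμ⟩ := exists_partition_null_frontier (μ : Measure X) hε
  obtain ⟨m, hm, q, hq0, hq1, hq⟩ := exists_integral_neg_log_orbitWord_lt hT.measurable hξ ha
  let info : (Fin m → Fin k) → ℝ := fun w => -Real.log (q w)
  have hword : Measurable (orbitWord T ξ m) := measurable_orbitWord hT.measurable hξ m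
  have hcont := tendsto_integral_comp_of_null_frontier hword
    (measure_frontier_orbitWord_preimage hT hμ hξμ) info
  refine ⟨{ν | ∫ x, info (orbitWord T ξ m x) ∂(ν : Measure X) < m * a},
    hcont.eventually_lt_const hq, m * (Fintype.card (Fin m → Fin k)) ^ 2, fun n => ?_⟩
  have hcover := coveredByBowenBalls_of_birkhoffSum_le (T := T) hξε hm hq0 hq1.le (n + 1)
    (a * (n + 1 : ℕ))
  refine hcover.mono fun x hx => ?_
  have hstrong : StronglyMeasurable fun y => info (orbitWord T ξ m y) :=
    ((Measurable.of_discrete (f := info)).comp hword).stronglyMeasurable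
  rw [mem_ofPred_eq, mem_ofPred_eq, integral_empiricalMeasure hstrong, birkhoffAverage, smul_eq_mul,
    inv_mul_lt_iff₀ (by positivity)] at hx
  exact hx.le.trans_eq (by ring)

theorem bowenMeasure_eq_zero_of_mapClusterPt (hT : Continuous T) {M : Set (ProbabilityMeasure X)}
    {a s : ℝ≥0} (has : a < s)
    (hM : ∀ μ ∈ M, μ ∈ invariantMeasures T ∧ measureEntropy T (μ : Measure X) < a)
    {Z : Set X} (hZ : ∀ x ∈ Z, ∃ μ ∈ M, MapClusterPt μ atTop (empiricalMeasure T x))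
    {ε : ℝ} (hε : 0 < ε) : bowenMeasure T s Z ε = 0 := by
  choose! U hU K hK using fun μ (hμ : μ ∈ M) =>
    exists_nhds_coveredByBowenBalls hT (hM μ hμ).1 (hM μ hμ).2 hε
  obtain ⟨D, hDM, hDc, hMD⟩ := TopologicalSpace.countable_cover_nhdsWithin
    fun μ hμ => mem_nhdsWithin_of_mem_nhds (interior_mem_nhds.2 (hU μ hμ))
  have := hDc.to_subtype
  let V : ProbabilityMeasure X → ℕ → Set X := fun ν n => {x | empiricalMeasure T x n ∈ U ν}
  have hZV : Z ⊆ ⋃ ν : D, limsup (V ν) atTop := fun x hx => by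
    obtain ⟨μ, hμ, hcluster⟩ := hZ x hx
    obtain ⟨ν, hν, hμν⟩ := mem_iUnion₂.1 (hMD hμ)
    exact mem_iUnion.2 ⟨⟨ν, hν⟩, mem_limsup_iff_frequently_mem.2
      (hcluster.frequently (mem_interior_iff_mem_nhds.1 hμν))⟩
  refine le_antisymm ?_ zero_le
  calc bowenMeasure T s Z ε ≤ bowenMeasure T s (⋃ ν : D, limsup (V ν) atTop) ε :=
        bowenMeasure_mono_set hZV
    _ ≤ ∑' ν : D, bowenMeasure T s (limsup (V ν) atTop) ε := bowenMeasure_iUnion_le _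
    _ = 0 := ENNReal.tsum_eq_zero.2 fun ν =>
        bowenMeasure_limsup_eq_zero_of_coveredByBowenBalls (NNReal.coe_lt_coe.2 has)
          (hK ν (hDM ν.2))

theorem topEntropy_le_of_mapClusterPt (hT : Continuous T) {Z : Set X} {t : ℝ≥0∞}
    (hZ : ∀ x ∈ Z, ∃ μ ∈ invariantMeasures T, measureEntropy T (μ : Measure X) ≤ t ∧
      MapClusterPt μ atTop (empiricalMeasure T x)) : topEntropy T Z ≤ t := by
  refine iSup₂_le fun ε hε => le_of_forall_gt fun b hb => ?_
  obtain ⟨s, hts, hsb⟩ := ENNReal.lt_iff_exists_nnreal_btwn.1 hb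
  obtain ⟨a, hta, has⟩ := ENNReal.lt_iff_exists_nnreal_btwn.1 hts
  refine (topEntropyAt_le ?_).trans_lt hsb
  refine bowenMeasure_eq_zero_of_mapClusterPt hT (ENNReal.coe_lt_coe.1 has)
    (M := {μ | μ ∈ invariantMeasures T ∧ measureEntropy T (μ : Measure X) ≤ t})
    (fun μ hμ => ⟨hμ.1, hμ.2.trans_lt hta⟩) (fun x hx => ?_) hε
  obtain ⟨μ, hμ, hμt, hcluster⟩ := hZ x hx
  exact ⟨μ, ⟨hμ, hμt⟩, hcluster⟩

end UpperBound

section LevelSets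

theorem birkhoffAverage_mem_of_convex {X E : Type*} [AddCommGroup E] [Module ℝ E] {T : X → X}
    {g : X → E} {s : Set E} (hs : Convex ℝ s) (hg : ∀ x, g x ∈ s) (x : X) {n : ℕ} (hn : n ≠ 0) :
    birkhoffAverage ℝ T g n x ∈ s := by
  rw [birkhoffAverage, birkhoffSum, Finset.smul_sum]
  refine hs.sum_mem (fun _ _ => by positivity) ?_ fun j _ => hg _
  rw [Finset.sum_const, Finset.card_range, nsmul_eq_mul]
  exact mul_inv_cancel₀ (Nat.cast_ne_zero.2 hn)

theorem birkhoffAverage_mem_closedConvexHull {X E : Type*} [AddCommGroup E] [Module ℝ E]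
    [TopologicalSpace E] {T : X → X} {Φ : X → E} (x : X) {n : ℕ} (hn : n ≠ 0) :
    birkhoffAverage ℝ T Φ n x ∈ closedConvexHull ℝ (range Φ) :=
  birkhoffAverage_mem_of_convex convex_closedConvexHull
    (fun _ => subset_closedConvexHull (mem_range_self _)) x hn

theorem tendsto_comp_birkhoffAverage {X E Y ι : Type*} [AddCommGroup E] [Module ℝ E]
    [TopologicalSpace E] [TopologicalSpace Y] {T : X → X} {Φ : X → E} {Ψ : E → Y}
    (hΨ : ContinuousOn Ψ (closedConvexHull ℝ (range Φ))) {l : Filter ι} [l.NeBot] {φ : ι → ℕ}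
    (hφ : ∀ᶠ i in l, φ i ≠ 0) {x : X} {α : E}
    (hα : Tendsto (fun i => birkhoffAverage ℝ T Φ (φ i) x) l (𝓝 α)) :
    Tendsto (fun i => Ψ (birkhoffAverage ℝ T Φ (φ i) x)) l (𝓝 (Ψ α)) := by
  have hmem : ∀ᶠ i in l, birkhoffAverage ℝ T Φ (φ i) x ∈ closedConvexHull ℝ (range Φ) :=
    hφ.mono fun i hi => birkhoffAverage_mem_closedConvexHull x hi
  have hαmem : α ∈ closedConvexHull ℝ (range Φ) := isClosed_closedConvexHull.mem_of_tendsto hα hmem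
  exact (hΨ α hαmem).tendsto.comp (tendsto_nhdsWithin_iff.2 ⟨hα, hmem⟩)

variable {X : Type*} {T : X → X} {B : Type*} [NormedAddCommGroup B]
  [NormedSpace ℝ B] {Φ : X → WeakDual ℝ B} {Y : Type*} {Ψ : WeakDual ℝ B → Y} {β : Y}

theorem limitLevelSet_subset_levelSet [TopologicalSpace Y]
    (hΨ : ContinuousOn Ψ (closedConvexHull ℝ (range Φ))) :
    limitLevelSet T Φ Ψ β ⊆ levelSet T Φ Ψ β := by
  rintro x ⟨α, hα, rfl⟩
  exact tendsto_comp_birkhoffAverage hΨ (eventually_ne_atTop 0) hα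

variable [MetricSpace X] [CompactSpace X] [MeasurableSpace X] [BorelSpace X] [CompleteSpace B]

theorem tendsto_birkhoffAverage_pettisIntegral (hΦ : Continuous Φ) {ι : Type*} {l : Filter ι}
    {φ : ι → ℕ} {x : X} {μ : ProbabilityMeasure X}
    (hμ : Tendsto (fun i => empiricalMeasure T x (φ i)) l (𝓝 μ)) :
    Tendsto (fun i => birkhoffAverage ℝ T Φ (φ i + 1) x) l (𝓝 (pettisIntegral hΦ μ)) := by
  refine tendsto_iff_forall_eval_tendsto_topDualPairing.2 fun w => ?_
  have hw : Continuous fun y => Φ y w := continuous_pairing hΦ w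
  have hint := ProbabilityMeasure.tendsto_iff_forall_integral_tendsto.1 hμ
    (BoundedContinuousFunction.mkOfCompact ⟨_, hw⟩)
  refine hint.congr fun i => ?_
  exact (integral_empiricalMeasure hw.stronglyMeasurable x (φ i)).trans
    (map_birkhoffAverage ℝ ℝ ((topDualPairing ℝ B).flip w) T Φ (φ i + 1) x).symm

theorem genericPoints_subset_limitLevelSet (hΦ : Continuous Φ) {μ : ProbabilityMeasure X}
    (hμ : μ ∈ measureLevelSet T hΦ Ψ β) : genericPoints T μ ⊆ limitLevelSet T Φ Ψ β :=
  fun _ hx => ⟨pettisIntegral hΦ μ, (tendsto_add_atTop_iff_nat 1).1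
    (tendsto_birkhoffAverage_pettisIntegral (φ := id) hΦ hx), hμ.2⟩

theorem iSup_measureEntropy_le_topEntropy_limitLevelSet (hsat : IsSaturated T)
    (hΦ : Continuous Φ) :
    ⨆ μ ∈ measureLevelSet T hΦ Ψ β, measureEntropy T (μ : Measure X) ≤
      topEntropy T (limitLevelSet T Φ Ψ β) :=
  iSup₂_le fun μ hμ => (hsat μ hμ.1).symm.trans_le
    (topEntropy_mono (genericPoints_subset_limitLevelSet hΦ hμ))

variable [TopologicalSpace Y]
  (hY : ∀ (u : ℕ → Y) (a b : Y), Tendsto u atTop (𝓝 a) → Tendsto u atTop (𝓝 b) → a = b)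

include hY

theorem exists_mem_measureLevelSet_mapClusterPt (hT : Continuous T) (hΦ : Continuous Φ)
    (hΨ : ContinuousOn Ψ (closedConvexHull ℝ (range Φ))) {x : X} (hx : x ∈ levelSet T Φ Ψ β) :
    ∃ μ ∈ measureLevelSet T hΦ Ψ β, MapClusterPt μ atTop (empiricalMeasure T x) := by
  obtain ⟨μ, hinv, φ, hφ, hμ⟩ := exists_tendsto_empiricalMeasure hT x
  have hlim : Tendsto (fun n => Ψ (birkhoffAverage ℝ T Φ (φ n + 1) x)) atTop
      (𝓝 (Ψ (pettisIntegral hΦ μ))) :=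
    tendsto_comp_birkhoffAverage hΨ (.of_forall fun n => (φ n).succ_ne_zero)
      (tendsto_birkhoffAverage_pettisIntegral hΦ hμ)
  have hlimβ : Tendsto (fun n => Ψ (birkhoffAverage ℝ T Φ (φ n + 1) x)) atTop (𝓝 β) :=
    hx.comp ((tendsto_add_atTop_nat 1).comp hφ.tendsto_atTop)
  exact ⟨μ, ⟨hinv, hY _ _ _ hlim hlimβ⟩, hμ.mapClusterPt.of_comp hφ.tendsto_atTop⟩

theorem levelSet_eq_empty (hT : Continuous T) (hΦ : Continuous Φ)
    (hΨ : ContinuousOn Ψ (closedConvexHull ℝ (range Φ)))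
    (h : measureLevelSet T hΦ Ψ β = ∅) : levelSet T Φ Ψ β = ∅ := by
  refine eq_empty_of_forall_notMem fun x hx => ?_
  obtain ⟨μ, hμ, -⟩ := exists_mem_measureLevelSet_mapClusterPt hY hT hΦ hΨ hx
  exact (h ▸ hμ : μ ∈ (∅ : Set (ProbabilityMeasure X)))

theorem topEntropy_levelSet_le (hT : Continuous T) (hΦ : Continuous Φ)
    (hΨ : ContinuousOn Ψ (closedConvexHull ℝ (range Φ))) :
    topEntropy T (levelSet T Φ Ψ β) ≤
      ⨆ μ ∈ measureLevelSet T hΦ Ψ β, measureEntropy T (μ : Measure X) :=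
  topEntropy_le_of_mapClusterPt hT fun x hx => by
    obtain ⟨μ, hμ, hcluster⟩ := exists_mem_measureLevelSet_mapClusterPt hY hT hΦ hΨ hx
    exact ⟨μ, hμ.1, le_iSup₂_of_le μ hμ le_rfl, hcluster⟩

end LevelSets

end SaturatedSystem

/-- `WeakDual ℝ B` is the dual of `B` with the weak star topology. `Ψ` is a function on the closed
convex hull of `Φ(X)`, extended arbitrarily outside it: only its values on the hull occur, and
continuity is required of its restriction to the hull only. The hypothesis `hY` says that limits of
sequences in `Y` are unique, as the notation `lim Ψ(A_n Φ(x)) = β` presupposes; every Hausdorff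
space satisfies it. -/
theorem theorem3 {X : Type*} [MetricSpace X] [CompactSpace X] [MeasurableSpace X] [BorelSpace X]
    {B : Type*} [NormedAddCommGroup B] [NormedSpace ℝ B] [CompleteSpace B]
    {Y : Type*} [TopologicalSpace Y]
    (hY : ∀ (u : ℕ → Y) (a b : Y), Tendsto u atTop (𝓝 a) → Tendsto u atTop (𝓝 b) → a = b)
    (T : X → X) (hT : Continuous T) (hsat : SaturatedSystem.IsSaturated T)
    (Φ : X → WeakDual ℝ B) (hΦ : Continuous Φ)
    (Ψ : WeakDual ℝ B → Y) (hΨ : ContinuousOn Ψ (closedConvexHull ℝ (Set.range Φ)))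
    (β : Y) :
    (SaturatedSystem.measureLevelSet T hΦ Ψ β = ∅ →
      SaturatedSystem.levelSet T Φ Ψ β = ∅) ∧
    ((SaturatedSystem.measureLevelSet T hΦ Ψ β).Nonempty →
      SaturatedSystem.topEntropy T (SaturatedSystem.levelSet T Φ Ψ β) =
          SaturatedSystem.topEntropy T (SaturatedSystem.limitLevelSet T Φ Ψ β) ∧
      SaturatedSystem.topEntropy T (SaturatedSystem.limitLevelSet T Φ Ψ β) =
          ⨆ μ ∈ SaturatedSystem.measureLevelSet T hΦ Ψ β,
            SaturatedSystem.measureEntropy T (μ : Measure X)) := by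
  have hlevel : SaturatedSystem.topEntropy T (SaturatedSystem.levelSet T Φ Ψ β) ≤
      ⨆ μ ∈ SaturatedSystem.measureLevelSet T hΦ Ψ β,
        SaturatedSystem.measureEntropy T (μ : Measure X) :=
    SaturatedSystem.topEntropy_levelSet_le hY hT hΦ hΨ
  have hgeneric : ⨆ μ ∈ SaturatedSystem.measureLevelSet T hΦ Ψ β,
      SaturatedSystem.measureEntropy T (μ : Measure X) ≤
        SaturatedSystem.topEntropy T (SaturatedSystem.limitLevelSet T Φ Ψ β) :=
    SaturatedSystem.iSup_measureEntropy_le_topEntropy_limitLevelSet hsat hΦ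
  have hsubset : SaturatedSystem.topEntropy T (SaturatedSystem.limitLevelSet T Φ Ψ β) ≤
      SaturatedSystem.topEntropy T (SaturatedSystem.levelSet T Φ Ψ β) :=
    SaturatedSystem.topEntropy_mono (SaturatedSystem.limitLevelSet_subset_levelSet hΨ)
  exact ⟨SaturatedSystem.levelSet_eq_empty hY hT hΦ hΨ, fun _ =>
    ⟨le_antisymm (hlevel.trans hgeneric) hsubset, le_antisymm (hsubset.trans hlevel) hgeneric⟩⟩
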